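/- Theorem. For a finite simple graph $G$ let $E(G)$ denote its energy, i.e. the sum of the absolute values of the eigenvalues (with multiplicity) of its adjacency matrix. For a positive integer $n$ and a set $D$ of positive divisors $d$ of $n$ with $d\le n/2$, let $\mathrm{ICG}_n(D)$ be the integral circulant graph: its vertices are the integers modulo $n$, and $a,b$ are adjacent if and only if $a-b\equiv s \pmod n$ for some $1\le s<n$ with $\gcd(s,n)\in D$. Let $n\ge 4$, let $p$ be a prime and $\gamma\ge 1$ an integer such that $p^\gamma\mid n$ and $p^\gamma\neq n$ (equivalently, $p^\gamma$ is a divisor of $n$ with $p^\gamma\le n/2$). Let $k$ be the number of distinct prime factors of $n$ and let $\varphi$ be Euler's totient function. Then the energy of $X_n(1,p^\gamma)=\mathrm{ICG}_n(\{1,p^\gamma\})$ is $$E(X_n(1,p^\gamma))=\begin{cases}2^{k-1}\bigl(\varphi(n)+\varphi(n/p)\bigr), & \text{if } p\mid n,\ p^2\nmid n \ (\text{so that } \gamma=1),\\[2pt] 2^{k-1}\bigl(2\varphi(n)+(p^\gamma-2p+2)\,\varphi(n/p^\gamma)\bigr), & \text{if } \gamma\ge 2,\ p^{\gamma}\mid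 n,\ p^{\gamma+1}\nmid n,\\[2pt] 2^{k}\bigl(\varphi(n)+(p^\gamma-p+1)\,\varphi(n/p^\gamma)\bigr), & \text{if } p^{\gamma+1}\mid n.\end{cases}$$ -/

import Mathlib

open Classical in
/-- The energy of a finite simple graph: the sum of the absolute values of the eigenvalues
(with multiplicity) of its adjacency matrix. -/
noncomputable def graphEnergy {V : Type*} [Fintype V] [DecidableEq V] (G : SimpleGraph V) : ℝ :=
  ∑ i : V, |(G.isHermitian_adjMatrix (R := ℝ)).eigenvalues i|

/-- `gcdClass n d` is the set of residues modulo `n` of the integers `k` with `1 ≤ k < n` and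
`gcd(k, n) = d`. -/
def gcdClass (n d : ℕ) : Set (ZMod n) :=
  {x | ∃ k : ℕ, 1 ≤ k ∧ k < n ∧ Nat.gcd k n = d ∧ x = (k : ZMod n)}

/-- The integral circulant graph on the integers modulo `n` with divisor set `D`: distinct vertices
`a, b` are adjacent iff `a - b` or `b - a` lies in the union of the sets `gcdClass n d`, `d ∈ D`
(a symmetric set that does not contain `0`). -/
def integralCirculantGraph (n : ℕ) (D : Set ℕ) : SimpleGraph (ZMod n) :=
  SimpleGraph.circulantGraph (⋃ d ∈ D, gcdClass n d)

/-! The adjacency matrix is convolution by the indicator of the residues with admissible gcd, so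
characters diagonalize it and the energy is the `ℓ¹`-norm of a Fourier transform
(`graphEnergy_eq_fourierEnergy`). This norm is multiplicative over direct products, and for `n = p ^
a * m` with `p ∤ m` the indicator factors under the Chinese remainder theorem
(`fourierEnergy_gcdIndicator_mul`). At a prime power the indicator is an alternating sum of
indicators of nested subgroups. Each transforms to a multiple of another such indicator
(`sum_dvdIndicator_mul_stdAddChar`), so the transform is constant on the layers of a chain, where
its sign is known. The cases of the formula reflect whether `γ = a` or `γ < a`. -/

open Classical in
/-- The `ℓ¹`-norm of the Fourier transform of `f`, summed over all complex characters. -/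
noncomputable def fourierEnergy {G : Type*} [AddCommGroup G] [Fintype G] (f : G → ℂ) : ℝ :=
  ∑ ψ : AddChar G ℂ, ‖∑ x, f x * ψ x‖

theorem fourierEnergy_congr_equiv {G H : Type*} [AddCommGroup G] [Fintype G] [AddCommGroup H]
    [Fintype H] (e : G ≃+ H) (f : H → ℂ) :
    fourierEnergy (fun x => f (e x)) = fourierEnergy f := by
  let E : AddChar H ℂ ≃ AddChar G ℂ :=
    { toFun := fun ψ => ψ.compAddMonoidHom e.toAddMonoidHom
      invFun := fun ψ => ψ.compAddMonoidHom e.symm.toAddMonoidHom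
      left_inv := fun ψ => by ext x; simp
      right_inv := fun ψ => by ext x; simp }
  unfold fourierEnergy
  rw [← E.sum_comp]
  refine Finset.sum_congr rfl fun ψ _ => ?_
  rw [← e.toEquiv.sum_comp]
  rfl

theorem fourierEnergy_prod {G H : Type*} [AddCommGroup G] [Fintype G] [AddCommGroup H]
    [Fintype H] (f : G → ℂ) (g : H → ℂ) :
    fourierEnergy (fun x : G × H => f x.1 * g x.2) = fourierEnergy f * fourierEnergy g := by
  let E : AddChar G ℂ × AddChar H ℂ ≃ AddChar (G × H) ℂ :=
    { toFun := fun ψ => ψ.1.compAddMonoidHom (AddMonoidHom.fst G H) *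
        ψ.2.compAddMonoidHom (AddMonoidHom.snd G H)
      invFun := fun ψ => (ψ.compAddMonoidHom (AddMonoidHom.inl G H),
        ψ.compAddMonoidHom (AddMonoidHom.inr G H))
      left_inv := fun ψ => by ext x <;> simp
      right_inv := fun ψ => by ext x; simp [← AddChar.map_add_eq_mul] }
  unfold fourierEnergy
  rw [← E.sum_comp, Fintype.sum_prod_type, Finset.sum_mul_sum]
  refine Finset.sum_congr rfl fun ψ _ => Finset.sum_congr rfl fun χ _ => ?_
  rw [← norm_mul, Finset.sum_mul_sum, Fintype.sum_prod_type]
  congr 1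
  refine Finset.sum_congr rfl fun x _ => Finset.sum_congr rfl fun y _ => ?_
  simp [E]
  ring

/-! ### Spectrum of a convolution matrix -/

theorem charpoly_convolution {G : Type*} [AddCommGroup G] [Fintype G] [DecidableEq G]
    (f : G → ℂ) (e : G ≃ AddChar G ℂ) :
    (Matrix.of fun a b : G => f (b - a)).charpoly =
      ∏ i, (Polynomial.X - Polynomial.C (∑ x, f x * e i x)) := by
  set M : Matrix G G ℂ := Matrix.of fun a b : G => f (b - a)
  set P : Matrix G G ℂ := Matrix.of fun x i => e i x
  -- Distinct characters are linearly independent, so the character table is a change of basis.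
  have hP : IsUnit P := by
    rw [← Matrix.linearIndependent_cols_iff_isUnit]
    exact (AddChar.linearIndependent G ℂ).comp e e.injective
  obtain ⟨u, hu⟩ := hP
  have h : M * P = P * Matrix.diagonal fun i => ∑ x, f x * e i x := by
    ext a i
    rw [Matrix.mul_diagonal, Matrix.mul_apply, ← Equiv.sum_comp (Equiv.addLeft a), Finset.mul_sum]
    refine Finset.sum_congr rfl fun x _ => ?_
    simp [M, P, AddChar.map_add_eq_mul]
    ring
  have h2 : M = u.val * (Matrix.diagonal fun i => ∑ x, f x * e i x) * u⁻¹.val := by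
    rw [hu, ← h, ← hu, mul_assoc, Units.mul_inv, mul_one]
  rw [h2, ← Matrix.charpoly_diagonal, mul_assoc, Matrix.charpoly_mul_comm, mul_assoc,
    Units.inv_mul, mul_one]

theorem graphEnergy_eq_fourierEnergy {G : Type*} [AddCommGroup G] [Fintype G] [DecidableEq G]
    (Γ : SimpleGraph G) (f : G → ℂ)
    (hf : ∀ a b, f (b - a) = open Classical in if Γ.Adj a b then 1 else 0) :
    graphEnergy Γ = fourierEnergy f := by
  classical
  have hA := Γ.isHermitian_adjMatrix (R := ℝ)
  obtain ⟨e⟩ : Nonempty (G ≃ AddChar G ℂ) := Fintype.card_eq.1 AddChar.card_eq.symm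
  have h1 := charpoly_convolution f e
  have h2 : (Matrix.of fun a b : G => f (b - a)) = (Γ.adjMatrix ℝ).map Complex.ofRealHom := by
    ext a b
    simp only [Matrix.of_apply, Matrix.map_apply, SimpleGraph.adjMatrix_apply, hf]
    split_ifs <;> simp
  rw [h2, Matrix.charpoly_map, hA.charpoly_eq, Polynomial.map_prod] at h1
  -- Comparing multisets of roots avoids matching the ordered eigenvalues with individual
  -- characters.
  have h3 := congrArg (fun p : Polynomial ℂ => (p.roots.map fun z => ‖z‖).sum) h1
  simp only [Polynomial.map_sub, Polynomial.map_X, Polynomial.map_C] at h3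
  have roots (g : G → ℂ) : (∏ i, (Polynomial.X - Polynomial.C (g i))).roots =
      Finset.univ.val.map g := by
    rw [← Polynomial.roots_multiset_prod_X_sub_C (Finset.univ.val.map g), Multiset.map_map]
    rfl
  rw [roots, roots, Multiset.map_map, Multiset.map_map] at h3
  unfold graphEnergy fourierEnergy
  rw [← e.sum_comp]
  convert! h3 using 1
  refine Finset.sum_congr rfl fun i _ => ?_
  simp

/-! ### Chinese remainder factorization -/

open Classical in
/-- The indicator function of the residues `x` modulo `n` with `gcd(x, n) ∈ D`. -/
noncomputable def gcdIndicator (n : ℕ) (D : Set ℕ) (x : ZMod n) : ℂ :=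
  if x.val.gcd n ∈ D then 1 else 0

theorem gcdIndicator_one_mul {M N q : ℕ} [NeZero M] [NeZero N] (h : M.Coprime N) (hq : q ∣ M)
    (x : ZMod (M * N)) :
    gcdIndicator (M * N) {1, q} x =
      gcdIndicator M {1, q} (ZMod.chineseRemainder h x).1 *
        gcdIndicator N {1} (ZMod.chineseRemainder h x).2 := by
  have h1 : (ZMod.chineseRemainder h x).1.val.gcd M = x.val.gcd M := by
    have : (ZMod.chineseRemainder h x).1 = (x.val : ZMod M) := by
      conv_lhs => rw [← ZMod.natCast_zmod_val x, map_natCast]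
      rfl
    rw [this, ZMod.val_natCast, (Nat.mod_modEq _ _).gcd_eq]
  have h2 : (ZMod.chineseRemainder h x).2.val.gcd N = x.val.gcd N := by
    have : (ZMod.chineseRemainder h x).2 = (x.val : ZMod N) := by
      conv_lhs => rw [← ZMod.natCast_zmod_val x, map_natCast]
      rfl
    rw [this, ZMod.val_natCast, (Nat.mod_modEq _ _).gcd_eq]
  have key : x.val.gcd (M * N) ∈ ({1, q} : Set ℕ) ↔
      x.val.gcd M ∈ ({1, q} : Set ℕ) ∧ x.val.gcd N ∈ ({1} : Set ℕ) := by
    rw [h.gcd_mul]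
    simp only [Set.mem_insert_iff, Set.mem_singleton_iff]
    constructor
    · intro H
      -- In either case this gcd divides `q`, hence `M`, which is coprime to `N`.
      have hN : x.val.gcd N = 1 := by
        refine Nat.eq_one_of_dvd_coprimes h ?_ (Nat.gcd_dvd_right _ _)
        rcases H with H | H
        · exact (Dvd.intro_left _ H).trans (one_dvd _)
        · exact (Dvd.intro_left _ H).trans hq
      rw [hN, mul_one] at H
      exact ⟨H, hN⟩
    · rintro ⟨H, hN⟩
      rwa [hN, mul_one]
  unfold gcdIndicator
  rw [h1, h2]
  by_cases ha : x.val.gcd M ∈ ({1, q} : Set ℕ) <;>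
    by_cases hb : x.val.gcd N ∈ ({1} : Set ℕ) <;> simp only [key, ha, hb] <;> simp

theorem fourierEnergy_gcdIndicator_mul {M N q : ℕ} [NeZero M] [NeZero N] (h : M.Coprime N)
    (hq : q ∣ M) :
    fourierEnergy (gcdIndicator (M * N) {1, q}) =
      fourierEnergy (gcdIndicator M {1, q}) * fourierEnergy (gcdIndicator N {1}) := by
  rw [← fourierEnergy_prod, ← fourierEnergy_congr_equiv (ZMod.chineseRemainder h).toAddEquiv]
  congr 1
  ext x
  exact gcdIndicator_one_mul h hq x

/-! ### Prime powers -/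

theorem fourierEnergy_zmod {N : ℕ} [NeZero N] (f : ZMod N → ℂ) :
    fourierEnergy f = ∑ j : ZMod N, ‖∑ x, f x * ZMod.stdAddChar (j * x)‖ := by
  have hb : Function.Bijective fun j : ZMod N => AddChar.mulShift (ZMod.stdAddChar (N := N)) j :=
    (Fintype.bijective_iff_injective_and_card _).2
      ⟨AddChar.to_mulShift_inj_of_isPrimitive (ZMod.isPrimitive_stdAddChar N),
        AddChar.card_eq.symm⟩
  unfold fourierEnergy
  rw [← hb.sum_comp]
  simp [AddChar.mulShift_apply]

/-- The indicator of `d ∣ x` for residues `x`, read off from the least nonnegative representative. -/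
def dvdIndicator (R : Type*) [Zero R] [One R] {N : ℕ} (d : ℕ) (x : ZMod N) : R :=
  if d ∣ x.val then 1 else 0

/-- Summing over the multiples of `d` gives a geometric series of length `e` whose ratio is an
`e`-th root of unity, equal to 1 exactly when `e ∣ j`. -/
theorem sum_dvdIndicator_mul_stdAddChar {N d e : ℕ} [NeZero N] (hN : N = d * e) (j : ZMod N) :
    ∑ x : ZMod N, dvdIndicator ℂ d x * ZMod.stdAddChar (j * x) = e * dvdIndicator ℂ e j := by
  have hN0 := NeZero.ne N
  have hd : 0 < d := Nat.pos_of_ne_zero (by rintro rfl; simp_all)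
  have he : 0 < e := Nat.pos_of_ne_zero (by rintro rfl; simp_all)
  have h1 : ∑ x : ZMod N, dvdIndicator ℂ d x * ZMod.stdAddChar (j * x) =
      ∑ y ∈ Finset.range e, ZMod.stdAddChar (j * (d : ZMod N)) ^ y := by
    simp only [dvdIndicator, ite_mul, one_mul, zero_mul]
    rw [← Finset.sum_filter]
    symm
    have hval (y : ℕ) (hy : y < e) : ((d * y : ℕ) : ZMod N).val = d * y :=
      ZMod.val_cast_of_lt (hN ▸ Nat.mul_lt_mul_of_pos_left hy hd)
    refine Finset.sum_bij (fun y _ => ((d * y : ℕ) : ZMod N)) ?_ ?_ ?_ ?_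
    · intro y hy
      rw [Finset.mem_filter, hval y (Finset.mem_range.1 hy)]
      exact ⟨Finset.mem_univ _, dvd_mul_right _ _⟩
    · intro y hy z hz hyz
      have := congrArg ZMod.val hyz
      rw [hval y (Finset.mem_range.1 hy), hval z (Finset.mem_range.1 hz)] at this
      exact Nat.eq_of_mul_eq_mul_left hd this
    · intro x hx
      obtain ⟨y, hy⟩ := (Finset.mem_filter.1 hx).2
      refine ⟨y, ?_, ?_⟩
      · have := ZMod.val_lt x
        rw [hy] at this
        exact Finset.mem_range.2 (Nat.lt_of_mul_lt_mul_left (this.trans_eq hN))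
      · rw [← hy, ZMod.natCast_zmod_val]
    · intro y _
      rw [← AddChar.map_nsmul_eq_pow, nsmul_eq_mul]
      push_cast
      ring_nf
  have h2 : ZMod.stdAddChar (j * (d : ZMod N)) = 1 ↔ e ∣ j.val := by
    rw [← AddChar.map_zero_eq_one (ZMod.stdAddChar (N := N)), ZMod.injective_stdAddChar.eq_iff]
    conv_lhs => rw [← ZMod.natCast_zmod_val j, ← Nat.cast_mul]
    rw [ZMod.natCast_eq_zero_iff, mul_comm j.val]
    conv_lhs => lhs; rw [hN]
    exact Nat.mul_dvd_mul_iff_left hd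
  have h3 : ZMod.stdAddChar (j * (d : ZMod N)) ^ e = 1 := by
    rw [← AddChar.map_nsmul_eq_pow, nsmul_eq_mul, mul_left_comm, ← Nat.cast_mul, mul_comm e,
      ← hN]
    simp
  rw [h1, dvdIndicator]
  split_ifs with h
  · simp [h2.2 h]
  · rw [geom_sum_eq (mt h2.1 h), h3]
    simp

theorem sum_dvdIndicator {N d e : ℕ} [NeZero N] (hN : N = d * e) :
    ∑ x : ZMod N, dvdIndicator ℝ d x = e := by
  have h := sum_dvdIndicator_mul_stdAddChar hN 0
  have h2 : ((∑ x : ZMod N, dvdIndicator ℝ d x : ℝ) : ℂ) = ((e : ℝ) : ℂ) := by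
    simpa [dvdIndicator, apply_ite Complex.ofReal] using h
  exact_mod_cast h2

theorem Nat.Prime.gcd_pow_eq_pow_iff {p : ℕ} (hp : p.Prime) {i a : ℕ} (hi : i < a) (v : ℕ) :
    v.gcd (p ^ a) = p ^ i ↔ p ^ i ∣ v ∧ ¬ p ^ (i + 1) ∣ v := by
  obtain ⟨k, hk, hg⟩ := (Nat.dvd_prime_pow hp).1 (Nat.gcd_dvd_right v (p ^ a))
  have key (b : ℕ) (hb : b ≤ a) : p ^ b ∣ v ↔ b ≤ k := by
    rw [← Nat.pow_dvd_pow_iff_le_right hp.one_lt, ← hg, Nat.dvd_gcd_iff]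
    exact ⟨fun h => ⟨h, pow_dvd_pow _ hb⟩, fun h => h.1⟩
  rw [hg, key i hi.le, key (i + 1) hi, (Nat.pow_right_injective hp.two_le).eq_iff]
  omega

theorem dvdIndicator_eq_zero_or_one {N d : ℕ} (x : ZMod N) :
    dvdIndicator ℝ d x = 0 ∨ dvdIndicator ℝ d x = 1 := by
  unfold dvdIndicator; split_ifs <;> simp

theorem dvdIndicator_le {N d e : ℕ} (h : d ∣ e) (x : ZMod N) :
    dvdIndicator ℝ e x ≤ dvdIndicator ℝ d x := by
  unfold dvdIndicator
  split_ifs with h1 h2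
  · rfl
  · exact absurd (h.trans h1) h2
  · exact zero_le_one
  · rfl

theorem ofReal_dvdIndicator {N d : ℕ} (x : ZMod N) :
    ((dvdIndicator ℝ d x : ℝ) : ℂ) = dvdIndicator ℂ d x := by
  unfold dvdIndicator; split_ifs <;> simp

theorem gcdIndicator_prime_pow_one {p a : ℕ} (hp : p.Prime) (ha : 1 ≤ a) (x : ZMod (p ^ a)) :
    gcdIndicator (p ^ a) {1} x = dvdIndicator ℂ (p ^ 0) x - dvdIndicator ℂ (p ^ 1) x := by
  have h := hp.gcd_pow_eq_pow_iff (Nat.lt_of_succ_le ha) x.val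
  simp only [pow_zero, one_dvd, true_and, zero_add] at h
  unfold gcdIndicator dvdIndicator
  simp only [Set.mem_singleton_iff, h, pow_zero, one_dvd, if_true]
  split_ifs <;> simp_all

theorem gcdIndicator_prime_pow_pair {p a γ : ℕ} (hp : p.Prime) (hγ : 1 ≤ γ) (ha : γ < a)
    (x : ZMod (p ^ a)) :
    gcdIndicator (p ^ a) {1, p ^ γ} x = dvdIndicator ℂ (p ^ 0) x - dvdIndicator ℂ (p ^ 1) x +
      dvdIndicator ℂ (p ^ γ) x - dvdIndicator ℂ (p ^ (γ + 1)) x := by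
  have h := hp.gcd_pow_eq_pow_iff (hγ.trans_lt ha).le x.val
  have h' := hp.gcd_pow_eq_pow_iff ha x.val
  simp only [pow_zero, one_dvd, true_and, zero_add] at h
  have h1 : p ^ γ ∣ x.val → p ^ 1 ∣ x.val := (pow_dvd_pow p hγ).trans
  have h2 : p ^ (γ + 1) ∣ x.val → p ^ γ ∣ x.val := (pow_dvd_pow p γ.le_succ).trans
  unfold gcdIndicator dvdIndicator
  simp only [Set.mem_insert_iff, Set.mem_singleton_iff, h, h', pow_zero, one_dvd, if_true]
  by_cases c1 : p ^ 1 ∣ x.val <;> by_cases c2 : p ^ γ ∣ x.val <;>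
    by_cases c3 : p ^ (γ + 1) ∣ x.val <;> simp_all

theorem gcdIndicator_prime_pow_self {p a : ℕ} (hp : p.Prime) (ha : 1 ≤ a) (x : ZMod (p ^ a)) :
    gcdIndicator (p ^ a) {1, p ^ a} x = dvdIndicator ℂ (p ^ 0) x - dvdIndicator ℂ (p ^ 1) x +
      dvdIndicator ℂ (p ^ a) x := by
  have h := hp.gcd_pow_eq_pow_iff (Nat.lt_of_succ_le ha) x.val
  simp only [pow_zero, one_dvd, true_and, zero_add] at h
  have h1 : p ^ a ∣ x.val → p ^ 1 ∣ x.val := (pow_dvd_pow p ha).trans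
  unfold gcdIndicator dvdIndicator
  simp only [Set.mem_insert_iff, Set.mem_singleton_iff, h, Nat.gcd_eq_right_iff_dvd, pow_zero,
    one_dvd, if_true]
  by_cases c1 : p ^ 1 ∣ x.val <;> by_cases c2 : p ^ a ∣ x.val <;> simp_all

theorem fourierEnergy_prime_pow_one {p a : ℕ} [NeZero (p ^ (a + 1))] (hp : p.Prime) :
    fourierEnergy (gcdIndicator (p ^ (a + 1)) {1}) = 2 * ((p : ℝ) ^ (a + 1) - (p : ℝ) ^ a) := by
  have hp1 : (1 : ℝ) ≤ p := by exact_mod_cast hp.one_lt.le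
  have hA : (p : ℝ) ^ a ≤ (p : ℝ) ^ (a + 1) := pow_le_pow_right₀ hp1 a.le_succ
  have hB : (0 : ℝ) ≤ (p : ℝ) ^ a := by positivity
  -- The coefficients are the increments of the absolute value along the chain of layers: 0, then `p
  -- ^ a`, then `p ^ (a + 1) - p ^ a`.
  have key (j : ZMod (p ^ (a + 1))) :
      ‖∑ x, gcdIndicator (p ^ (a + 1)) {1} x * ZMod.stdAddChar (j * x)‖ =
        (p : ℝ) ^ a * dvdIndicator ℝ (p ^ a) j +
          ((p : ℝ) ^ (a + 1) - 2 * (p : ℝ) ^ a) * dvdIndicator ℝ (p ^ (a + 1)) j := by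
    simp only [gcdIndicator_prime_pow_one hp (Nat.le_add_left 1 a), sub_mul, Finset.sum_sub_distrib]
    rw [sum_dvdIndicator_mul_stdAddChar (e := p ^ (a + 1)) (by ring),
      sum_dvdIndicator_mul_stdAddChar (e := p ^ a) (by ring)]
    have hle := dvdIndicator_le (pow_dvd_pow p (Nat.le_add_right a 1)) j
    rw [← ofReal_dvdIndicator, ← ofReal_dvdIndicator]
    push_cast
    norm_cast
    rw [Real.norm_eq_abs]
    push_cast
    rcases dvdIndicator_eq_zero_or_one (d := p ^ a) j with h1 | h1 <;>
      rcases dvdIndicator_eq_zero_or_one (d := p ^ (a + 1)) j with h2 | h2 <;>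
      rw [h1, h2] at hle ⊢ <;> first | linarith | skip
    · simp
    · rw [abs_of_nonpos] <;> linarith
    · rw [abs_of_nonneg] <;> linarith
  rw [fourierEnergy_zmod]
  simp only [key]
  rw [Finset.sum_add_distrib, ← Finset.mul_sum, ← Finset.mul_sum,
    sum_dvdIndicator (e := p) (by ring), sum_dvdIndicator (e := 1) (by ring)]
  push_cast
  ring

theorem fourierEnergy_prime_pow_self {p a : ℕ} [NeZero (p ^ (a + 1))] (hp : p.Prime) :
    fourierEnergy (gcdIndicator (p ^ (a + 1)) {1, p ^ (a + 1)}) =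
      2 * ((p : ℝ) ^ (a + 1) - (p : ℝ) ^ a) + ((p : ℝ) ^ (a + 1) - 2 * p + 2) := by
  have hp1 : (1 : ℝ) ≤ p := by exact_mod_cast hp.one_lt.le
  have hA : (p : ℝ) ^ a ≤ (p : ℝ) ^ (a + 1) := pow_le_pow_right₀ hp1 a.le_succ
  have hB : (1 : ℝ) ≤ (p : ℝ) ^ a := one_le_pow₀ hp1
  -- The transform takes the values `1`, `1 - p ^ a` and `p ^ (a + 1) - p ^ a + 1` on successive
  -- layers; the coefficients are the increments of their absolute values.
  have key (j : ZMod (p ^ (a + 1))) :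
      ‖∑ x, gcdIndicator (p ^ (a + 1)) {1, p ^ (a + 1)} x * ZMod.stdAddChar (j * x)‖ =
        dvdIndicator ℝ 1 j + ((p : ℝ) ^ a - 2) * dvdIndicator ℝ (p ^ a) j +
          ((p : ℝ) ^ (a + 1) - 2 * (p : ℝ) ^ a + 2) * dvdIndicator ℝ (p ^ (a + 1)) j := by
    simp only [gcdIndicator_prime_pow_self hp (Nat.le_add_left 1 a), sub_mul, add_mul,
      Finset.sum_sub_distrib, Finset.sum_add_distrib]
    rw [sum_dvdIndicator_mul_stdAddChar (e := p ^ (a + 1)) (by ring),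
      sum_dvdIndicator_mul_stdAddChar (e := p ^ a) (by ring),
      sum_dvdIndicator_mul_stdAddChar (e := 1) (by ring)]
    have hle := dvdIndicator_le (pow_dvd_pow p (Nat.le_add_right a 1)) j
    have h0 : dvdIndicator ℝ 1 j = 1 := by simp [dvdIndicator]
    rw [← ofReal_dvdIndicator, ← ofReal_dvdIndicator, ← ofReal_dvdIndicator, h0]
    push_cast
    norm_cast
    rw [Real.norm_eq_abs]
    push_cast
    rcases dvdIndicator_eq_zero_or_one (d := p ^ a) j with h1 | h1 <;>
      rcases dvdIndicator_eq_zero_or_one (d := p ^ (a + 1)) j with h2 | h2 <;>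
      rw [h1, h2] at hle ⊢ <;> first | linarith | skip
    · simp
    · rw [abs_of_nonpos] <;> linarith
    · rw [abs_of_nonneg] <;> linarith
  rw [fourierEnergy_zmod]
  simp only [key]
  rw [Finset.sum_add_distrib, Finset.sum_add_distrib, ← Finset.mul_sum, ← Finset.mul_sum,
    sum_dvdIndicator (e := p ^ (a + 1)) (by ring),
    sum_dvdIndicator (e := p) (by ring), sum_dvdIndicator (e := 1) (by ring)]
  push_cast
  ring

theorem fourierEnergy_prime_pow_pair {p g c : ℕ} [NeZero (p ^ (c + g + 2))] (hp : p.Prime) :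
    fourierEnergy (gcdIndicator (p ^ (c + g + 2)) {1, p ^ (g + 1)}) =
      2 * ((p : ℝ) ^ (c + g + 2) - (p : ℝ) ^ (c + g + 1) +
        ((p : ℝ) ^ (g + 1) - p + 1) * ((p : ℝ) ^ (c + 1) - (p : ℝ) ^ c)) := by
  have hp2 : (2 : ℝ) ≤ p := by exact_mod_cast hp.two_le
  have hp1 : (1 : ℝ) ≤ p := by linarith
  have hA : (p : ℝ) ^ (c + g + 1) ≤ (p : ℝ) ^ (c + g + 2) := pow_le_pow_right₀ hp1 (by omega)
  have hB : (p : ℝ) ^ (c + 1) ≤ (p : ℝ) ^ (c + g + 1) := pow_le_pow_right₀ hp1 (by omega)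
  have hC : (p : ℝ) ^ c ≤ (p : ℝ) ^ (c + 1) := pow_le_pow_right₀ hp1 (by omega)
  have hD : (0 : ℝ) ≤ (p : ℝ) ^ c := by positivity
  -- Each new layer's term dominates the sum of the earlier ones, so the signs alternate.
  have key (j : ZMod (p ^ (c + g + 2))) :
      ‖∑ x, gcdIndicator (p ^ (c + g + 2)) {1, p ^ (g + 1)} x * ZMod.stdAddChar (j * x)‖ =
        (p : ℝ) ^ c * dvdIndicator ℝ (p ^ c) j +
          ((p : ℝ) ^ (c + 1) - 2 * (p : ℝ) ^ c) * dvdIndicator ℝ (p ^ (c + 1)) j +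
          ((p : ℝ) ^ (c + g + 1) - 2 * (p : ℝ) ^ (c + 1) + 2 * (p : ℝ) ^ c) *
            dvdIndicator ℝ (p ^ (c + g + 1)) j +
          ((p : ℝ) ^ (c + g + 2) - 2 * (p : ℝ) ^ (c + g + 1) + 2 * (p : ℝ) ^ (c + 1) -
            2 * (p : ℝ) ^ c) * dvdIndicator ℝ (p ^ (c + g + 2)) j := by
    simp only [gcdIndicator_prime_pow_pair hp (Nat.le_add_left 1 g)
      (show g + 1 < c + g + 2 by omega), sub_mul, add_mul,
      Finset.sum_sub_distrib, Finset.sum_add_distrib]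
    rw [sum_dvdIndicator_mul_stdAddChar (e := p ^ (c + g + 2)) (by ring),
      sum_dvdIndicator_mul_stdAddChar (e := p ^ (c + g + 1)) (by ring),
      sum_dvdIndicator_mul_stdAddChar (e := p ^ (c + 1)) (by ring),
      sum_dvdIndicator_mul_stdAddChar (e := p ^ c) (by ring)]
    have l1 := dvdIndicator_le (pow_dvd_pow p (show c + g + 1 ≤ c + g + 2 by omega)) j
    have l2 := dvdIndicator_le (pow_dvd_pow p (show c + 1 ≤ c + g + 1 by omega)) j
    have l3 := dvdIndicator_le (pow_dvd_pow p (show c ≤ c + 1 by omega)) j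
    simp only [← ofReal_dvdIndicator]
    push_cast
    norm_cast
    rw [Real.norm_eq_abs]
    push_cast
    rcases dvdIndicator_eq_zero_or_one (d := p ^ (c + g + 2)) j with h1 | h1 <;>
      rcases dvdIndicator_eq_zero_or_one (d := p ^ (c + g + 1)) j with h2 | h2 <;>
      rcases dvdIndicator_eq_zero_or_one (d := p ^ (c + 1)) j with h3 | h3 <;>
      rcases dvdIndicator_eq_zero_or_one (d := p ^ c) j with h4 | h4 <;>
      simp only [h1, h2, h3, h4] at l1 l2 l3 ⊢ <;> first | linarith | skip
    -- Nesting leaves five of the sixteen patterns, one per layer.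
    · simp
    · rw [abs_of_nonpos] <;> linarith
    · rw [abs_of_nonneg] <;> linarith
    · rw [abs_of_nonpos] <;> linarith
    · rw [abs_of_nonneg] <;> linarith
  rw [fourierEnergy_zmod]
  simp only [key]
  rw [Finset.sum_add_distrib, Finset.sum_add_distrib, Finset.sum_add_distrib, ← Finset.mul_sum,
    ← Finset.mul_sum, ← Finset.mul_sum, ← Finset.mul_sum,
    sum_dvdIndicator (e := p ^ (g + 2)) (by ring), sum_dvdIndicator (e := p ^ (g + 1)) (by ring),
    sum_dvdIndicator (e := p) (by ring), sum_dvdIndicator (e := 1) (by ring)]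
  push_cast
  ring

theorem fourierEnergy_gcdIndicator_one (n : ℕ) [hn : NeZero n] :
    fourierEnergy (gcdIndicator n {1}) = 2 ^ n.primeFactors.card * (n.totient : ℝ) := by
  revert hn
  induction n using Nat.recOnPosPrimePosCoprime with
  | zero =>
    intro hn
    exact absurd rfl hn.out
  | one =>
    intro _
    have : gcdIndicator 1 {1} = fun _ => 1 := by ext; simp [gcdIndicator]
    rw [fourierEnergy_zmod, this, Fintype.sum_unique, Fintype.sum_unique]
    simp
  | prime_pow p a hp ha =>
    obtain ⟨b, rfl⟩ := Nat.exists_eq_add_of_le' ha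
    intro _
    rw [fourierEnergy_prime_pow_one hp, Nat.primeFactors_prime_pow (by omega) hp,
      Nat.totient_prime_pow_succ hp, Finset.card_singleton]
    push_cast [hp.one_le]
    ring
  | coprime M N hM hN h ihM ihN =>
    intro _
    have : NeZero M := ⟨by omega⟩
    have : NeZero N := ⟨by omega⟩
    have H := fourierEnergy_gcdIndicator_mul h (one_dvd M)
    simp only [Set.pair_eq_singleton] at H
    rw [H, ihM, ihN, h.primeFactors_mul, Finset.card_union_of_disjoint h.disjoint_primeFactors,
      Nat.totient_mul h]
    push_cast
    ring

/-- Since `gcd(0, n) = n`, the hypothesis excludes loops; negation preserves the gcd, so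
symmetrizing adds no edges. -/
theorem integralCirculantGraph_adj {n : ℕ} [NeZero n] {D : Set ℕ} (hD : n ∉ D) (a b : ZMod n) :
    (integralCirculantGraph n D).Adj a b ↔ (b - a).val.gcd n ∈ D := by
  have hmem (x : ZMod n) : (x ∈ ⋃ d ∈ D, gcdClass n d) ↔ x.val.gcd n ∈ D := by
    simp only [Set.mem_iUnion, gcdClass, Set.mem_ofPred_eq, exists_prop]
    constructor
    · rintro ⟨d, hd, k, -, hk, rfl, rfl⟩
      rwa [ZMod.val_cast_of_lt hk]
    · intro h
      refine ⟨_, h, x.val, Nat.one_le_iff_ne_zero.2 fun h0 => hD ?_, ZMod.val_lt x, rfl,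
        (ZMod.natCast_zmod_val x).symm⟩
      rwa [h0, Nat.gcd_zero_left] at h
  have hneg (x : ZMod n) : (-x).val.gcd n = x.val.gcd n := by
    rw [ZMod.neg_val]
    split_ifs with h
    · simp [h]
    · rw [Nat.gcd_self_sub_left (ZMod.val_lt x).le]
  unfold integralCirculantGraph SimpleGraph.circulantGraph
  rw [SimpleGraph.fromRel_adj, hmem, hmem, ← neg_sub b a, hneg, or_self, and_iff_right_iff_imp]
  rintro h rfl
  simp at h
  exact hD h

theorem graphEnergy_integralCirculantGraph {n : ℕ} [NeZero n] {D : Set ℕ} (hD : n ∉ D) :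
    graphEnergy (integralCirculantGraph n D) = fourierEnergy (gcdIndicator n D) := by
  classical
  refine graphEnergy_eq_fourierEnergy _ _ fun a b => ?_
  unfold gcdIndicator
  simp only [integralCirculantGraph_adj hD]

theorem graphEnergy_prime_pow_mul {p a γ m : ℕ} [NeZero (p ^ a * m)] (hp : p.Prime)
    (hm : ¬ p ∣ m) (ha : γ ≤ a) (h1 : p ^ a * m ≠ 1) (hlt : p ^ γ < p ^ a * m)
    [NeZero (p ^ a)] :
    graphEnergy (integralCirculantGraph (p ^ a * m) {1, p ^ γ}) =
      fourierEnergy (gcdIndicator (p ^ a) {1, p ^ γ}) *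
        (2 ^ m.primeFactors.card * (m.totient : ℝ)) := by
  have : NeZero m := ⟨by rintro rfl; simp at hm⟩
  rw [graphEnergy_integralCirculantGraph (by simp [h1, hlt.ne']),
    fourierEnergy_gcdIndicator_mul (((Nat.Prime.coprime_iff_not_dvd hp).2 hm).pow_left a)
      (pow_dvd_pow p ha), fourierEnergy_gcdIndicator_one]

theorem mainTheorem3 (n p γ : ℕ) [NeZero n] (hn : 4 ≤ n) (hp : p.Prime) (hγ : 1 ≤ γ)
    (hdvd : p ^ γ ∣ n) (hlt : p ^ γ < n) :
    (p ∣ n ∧ ¬ p ^ 2 ∣ n →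
      graphEnergy (integralCirculantGraph n {1, p ^ γ}) =
        2 ^ (n.primeFactors.card - 1) *
          ((Nat.totient n : ℝ) + (Nat.totient (n / p) : ℝ))) ∧
    (p ^ γ ∣ n ∧ ¬ p ^ (γ + 1) ∣ n ∧ 2 ≤ γ →
      graphEnergy (integralCirculantGraph n {1, p ^ γ}) =
        2 ^ (n.primeFactors.card - 1) *
          (2 * (Nat.totient n : ℝ) +
            ((p : ℝ) ^ γ - 2 * (p : ℝ) + 2) * (Nat.totient (n / p ^ γ) : ℝ))) ∧
    (p ^ (γ + 1) ∣ n →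
      graphEnergy (integralCirculantGraph n {1, p ^ γ}) =
        2 ^ n.primeFactors.card *
          ((Nat.totient n : ℝ) +
            ((p : ℝ) ^ γ - (p : ℝ) + 1) * (Nat.totient (n / p ^ γ) : ℝ))) := by
  obtain ⟨a, m, hm, rfl⟩ := Nat.exists_eq_pow_mul_and_not_dvd (NeZero.ne n) p hp.ne_one
  have : NeZero p := ⟨hp.ne_zero⟩
  have hpm : p.Coprime m := (Nat.Prime.coprime_iff_not_dvd hp).2 hm
  have hdiv (i : ℕ) : p ^ i ∣ p ^ a * m ↔ i ≤ a := by
    rw [(hpm.pow_left i).dvd_mul_right, Nat.pow_dvd_pow_iff_le_right hp.one_lt]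
  have ha : γ ≤ a := (hdiv γ).1 hdvd
  have hcop (i : ℕ) : (p ^ i).Coprime m := hpm.pow_left i
  have hcard : (p ^ a * m).primeFactors.card = m.primeFactors.card + 1 := by
    rw [(hcop a).primeFactors_mul, Finset.card_union_of_disjoint (hcop a).disjoint_primeFactors,
      Nat.primeFactors_prime_pow (by omega) hp, Finset.card_singleton, add_comm]
  have hquot (i j : ℕ) : p ^ (i + j) * m / p ^ i = p ^ j * m := by
    rw [pow_add, mul_assoc, Nat.mul_div_cancel_left _ (pow_pos hp.pos i)]
  have htot (i : ℕ) : (Nat.totient (p ^ (i + 1) * m) : ℝ) =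
      ((p : ℝ) ^ (i + 1) - (p : ℝ) ^ i) * (m.totient : ℝ) := by
    rw [Nat.totient_mul (hcop _), Nat.totient_prime_pow_succ hp]
    push_cast [hp.one_le]
    ring
  rw [graphEnergy_prime_pow_mul hp hm ha (by omega) hlt, hcard, Nat.add_sub_cancel, hdiv, hdiv,
    hdiv]
  obtain ⟨g, rfl⟩ := Nat.exists_eq_add_of_le' hγ
  refine ⟨fun ⟨_, h⟩ => ?_, fun ⟨_, h, _⟩ => ?_, fun h => ?_⟩
  · obtain rfl : a = 1 := by omega
    obtain rfl : g = 0 := by omega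
    have hq := hquot 1 0
    simp only [add_zero, pow_one, pow_zero, one_mul] at hq
    have ht := htot 0
    -- At `a = 0` the local factor collapses to `p = (p - 1) + 1`, whence `φ(n) + φ(n / p)`.
    have hF := fourierEnergy_prime_pow_self (a := 0) hp
    simp only [zero_add] at hF ht ⊢
    rw [hF, ht, pow_one p, hq]
    ring
  · obtain rfl : a = g + 1 := by omega
    have hq := hquot (g + 1) 0
    simp only [add_zero, pow_zero, one_mul] at hq
    rw [fourierEnergy_prime_pow_self hp, hq, htot]
    ring
  · obtain ⟨c, rfl⟩ : ∃ c, a = c + g + 2 := ⟨a - g - 2, by omega⟩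
    have hq := hquot (g + 1) (c + 1)
    rw [show g + 1 + (c + 1) = c + g + 2 by ring] at hq
    rw [fourierEnergy_prime_pow_pair hp, hq, htot (c + g + 1), htot]
    ring
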